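/- Let $E$ and $F$ be (real) Banach lattices and let $S,T:E\to F$ be bounded linear operators with $0\le S\le T$, i.e. $0\le Sx\le Tx$ for every $x\in E$ with $x\ge 0$. If $T$ is limitedly L-weakly compact, then $S$ is limitedly L-weakly compact. Here a bounded subset $A$ of a Banach space $X$ is called \emph{limited} if every weak$^\ast$-null sequence $(f_n)$ in the dual $X'$ is uniformly null on $A$, i.e. $\sup_{x\in A}|f_n(x)|\to 0$. A subset $B$ of $F$ is called an \emph{Lwc-set} if every disjoint sequence in its solid hull $\mathrm{sol}(B)=\bigcup_{b\in B}[-|b|,|b|]$ (disjoint: $|b_m|\wedge|b_n|=0$ for $m\ne n$) is norm-null. A bounded linear operator $T:X\to F$ is called \emph{limitedly L-weakly compact} if $T(A)$ is an Lwc-set in $F$ for every limited subset $A$ of $X$. -/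

import Mathlib

open Filter Topology

/-- A bounded subset `A` of a Banach space `X` is *limited* if every weak-star null sequence in the
dual of `X` converges to zero uniformly on `A`. -/
def IsLimitedSet {X : Type*} [NormedAddCommGroup X] [NormedSpace ℝ X] (A : Set X) : Prop :=
  Bornology.IsBounded A ∧
    ∀ f : ℕ → WeakDual ℝ X, Tendsto f atTop (𝓝 0) →
      TendstoUniformlyOn (fun n x => f n x) (fun _ => (0 : ℝ)) atTop A

/-- A sequence in a vector lattice is *disjoint* if its terms are pairwise disjoint, that is,
`|aₘ| ∧ |aₙ| = 0` for `m ≠ n`. -/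
def IsDisjointSeq {F : Type*} [AddCommGroup F] [Lattice F] (a : ℕ → F) : Prop :=
  ∀ m n : ℕ, m ≠ n → |a m| ⊓ |a n| = 0

/-- A subset `A` of a Banach lattice is an *Lwc-set* if every disjoint sequence in the solid hull
of `A` is norm-null. -/
def IsLwcSet {F : Type*} [NormedAddCommGroup F] [Lattice F] (A : Set F) : Prop :=
  ∀ a : ℕ → F, (∀ n, a n ∈ LatticeOrderedAddCommGroup.solidClosure A) → IsDisjointSeq a →
    Tendsto (fun n => ‖a n‖) atTop (𝓝 0)

/-- A bounded operator from a Banach space to a Banach lattice is *limitedly L-weakly compact* if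
it carries limited sets onto Lwc-sets. -/
def IsLimitedlyLwc {X F : Type*} [NormedAddCommGroup X] [NormedSpace ℝ X]
    [NormedAddCommGroup F] [NormedSpace ℝ F] [Lattice F] (T : X →L[ℝ] F) : Prop :=
  ∀ A : Set X, IsLimitedSet A → IsLwcSet (T '' A)

/-- The order between operators of Banach lattices: `S ≤ T` if `S x ≤ T x` for all `x ≥ 0`. -/
def OperatorLE {E F : Type*} [NormedAddCommGroup E] [NormedSpace ℝ E] [Lattice E]
    [NormedAddCommGroup F] [NormedSpace ℝ F] [Lattice F] (S T : E →L[ℝ] F) : Prop :=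
  ∀ x : E, 0 ≤ x → S x ≤ T x

/-! Let `z n` be disjoint with `|z n| ≤ |S (a n)|`, `a n` in a limited set `A`. The seminorm `p n w
= sup_k ‖|w| ⊓ |k • z n|‖` is monotone in `|w|` and tends to zero whenever `{w}` is an Lwc-set.
Singletons are limited, so `p n (T y) → 0`, and domination gives `p n (S y) → 0` for `y ≥ 0`, hence
for all `y`. Hahn–Banach gives functionals `h n` with `|h n| ≤ p n`, attaining `p n` at `S (a n)`.
Then `h n ∘ S` is weak-star null, hence uniformly null on `A`, while `‖z n‖ ≤ p n (S (a n)) = h n (S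
(a n))`. -/

section VectorLattice

variable {F : Type*} [AddCommGroup F] [Lattice F] [IsOrderedAddMonoid F]

theorem add_inf_le_inf_add_inf {a b c : F} (ha : 0 ≤ a) (hb : 0 ≤ b) (hc : 0 ≤ c) :
    (a + b) ⊓ c ≤ a ⊓ c + b ⊓ c := by
  rw [inf_add, add_inf, add_inf]
  refine le_inf (le_inf inf_le_left ?_) (le_inf ?_ ?_) <;> refine inf_le_right.trans ?_
  · exact le_add_of_nonneg_left ha
  · exact le_add_of_nonneg_right hb
  · exact le_add_of_nonneg_right hc

theorem abs_add_inf_le {x y c : F} (hc : 0 ≤ c) : |x + y| ⊓ c ≤ |x| ⊓ c + |y| ⊓ c :=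
  (inf_le_inf_right c (abs_add_le x y)).trans
    (add_inf_le_inf_add_inf (abs_nonneg x) (abs_nonneg y) hc)

theorem smul_inf_of_pos {F : Type*} [AddCommGroup F] [Lattice F] [Module ℝ F]
    [IsOrderedModule ℝ F] {c : ℝ} (hc : 0 < c) (a b : F) : c • (a ⊓ b) = c • a ⊓ c • b :=
  (OrderIso.smulRight (β := F) hc).map_inf a b

variable [Module ℝ F] [IsOrderedModule ℝ F]

theorem abs_smul_eq_abs_smul_abs (r : ℝ) (a : F) : |r • a| = |r| • |a| := by
  have key (c : ℝ) (hc : 0 < c) : |c • a| = c • |a| := by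
    rw [abs, abs, ← smul_neg]
    exact ((OrderIso.smulRight (β := F) hc).map_sup a (-a)).symm
  rcases lt_trichotomy r 0 with hr | rfl | hr
  · rw [abs_of_neg hr, ← key _ (neg_pos.mpr hr), neg_smul, abs_neg]
  · simp
  · rw [abs_of_pos hr, key r hr]

theorem abs_smul_inf_abs_smul_eq_zero {a b : F} (h : |a| ⊓ |b| = 0) (k l : ℝ) :
    |k • a| ⊓ |l • b| = 0 := by
  -- A common bound for `|k|` and `|l|`; the `1` keeps it positive, so that scaling by it preserves
  -- infima.
  set c : ℝ := |k| + |l| + 1 with hc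
  have hc0 : 0 < c := by positivity
  refine le_antisymm ?_ (le_inf (abs_nonneg _) (abs_nonneg _))
  calc |k • a| ⊓ |l • b| ≤ c • |a| ⊓ c • |b| := by
        rw [abs_smul_eq_abs_smul_abs, abs_smul_eq_abs_smul_abs]
        refine inf_le_inf (smul_le_smul_of_nonneg_right ?_ (abs_nonneg a))
          (smul_le_smul_of_nonneg_right ?_ (abs_nonneg b)) <;>
        linarith [abs_nonneg k, abs_nonneg l]
    _ = 0 := by rw [← smul_inf_of_pos hc0, h, smul_zero]

end VectorLattice

section Truncation

variable {F : Type*} [NormedAddCommGroup F] [NormedSpace ℝ F]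
    [Lattice F] [IsOrderedAddMonoid F] [IsOrderedModule ℝ F] [HasSolidNorm F]

theorem norm_le_norm_of_nonneg_of_le {F : Type*} [NormedAddCommGroup F] [Lattice F]
    [IsOrderedAddMonoid F] [HasSolidNorm F] {a b : F} (ha : 0 ≤ a) (hab : a ≤ b) : ‖a‖ ≤ ‖b‖ :=
  norm_le_norm_of_abs_le_abs (by rwa [abs_of_nonneg ha, abs_of_nonneg (ha.trans hab)])

theorem norm_abs_inf_abs_le {F : Type*} [NormedAddCommGroup F] [Lattice F]
    [IsOrderedAddMonoid F] [HasSolidNorm F] (x y : F) : ‖|x| ⊓ |y|‖ ≤ ‖x‖ :=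
  (norm_le_norm_of_nonneg_of_le (le_inf (abs_nonneg x) (abs_nonneg y)) inf_le_left).trans_eq
    (norm_abs_eq_norm x)

theorem bddAbove_range_norm_abs_inf {F : Type*} [NormedAddCommGroup F] [NormedSpace ℝ F]
    [Lattice F] [IsOrderedAddMonoid F] [HasSolidNorm F] (z x : F) :
    BddAbove (Set.range fun k : ℝ => ‖|x| ⊓ |k • z|‖) :=
  ⟨‖x‖, by rintro _ ⟨k, rfl⟩; exact norm_abs_inf_abs_le x _⟩

/-- The seminorm `x ↦ sup_k ‖|x| ⊓ |k z|‖`, measuring the part of `x` in the band generated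
by `z`. -/
noncomputable def truncationSeminorm (z : F) : Seminorm ℝ F :=
  Seminorm.ofSMulLE (fun x => ⨆ k : ℝ, ‖|x| ⊓ |k • z|‖)
    (by simp)
    (fun x y => ciSup_le fun k => by
      calc ‖|x + y| ⊓ |k • z|‖ ≤ ‖|x| ⊓ |k • z| + |y| ⊓ |k • z|‖ :=
            norm_le_norm_of_nonneg_of_le (le_inf (abs_nonneg _) (abs_nonneg _))
              (abs_add_inf_le (abs_nonneg _))
        _ ≤ ‖|x| ⊓ |k • z|‖ + ‖|y| ⊓ |k • z|‖ := norm_add_le _ _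
        _ ≤ _ := add_le_add (le_ciSup (bddAbove_range_norm_abs_inf z x) k)
              (le_ciSup (bddAbove_range_norm_abs_inf z y) k))
    (fun r x => ciSup_le fun k => by
      rcases eq_or_ne r 0 with rfl | hr
      · simp
      · have h : |r • x| ⊓ |k • z| = |r| • (|x| ⊓ |(r⁻¹ * k) • z|) := by
          rw [smul_inf_of_pos (abs_pos.mpr hr), ← abs_smul_eq_abs_smul_abs,
            ← abs_smul_eq_abs_smul_abs, smul_smul, mul_inv_cancel_left₀ hr]
        rw [h, norm_smul, Real.norm_eq_abs, Real.norm_eq_abs, abs_abs]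
        exact mul_le_mul_of_nonneg_left (le_ciSup (bddAbove_range_norm_abs_inf z x) (r⁻¹ * k))
          (abs_nonneg r))

theorem truncationSeminorm_apply (z x : F) :
    truncationSeminorm z x = ⨆ k : ℝ, ‖|x| ⊓ |k • z|‖ := rfl

theorem truncationSeminorm_le_norm (z x : F) : truncationSeminorm z x ≤ ‖x‖ :=
  ciSup_le fun _ => norm_abs_inf_abs_le x _

theorem truncationSeminorm_mono (z : F) {x y : F} (h : |x| ≤ |y|) :
    truncationSeminorm z x ≤ truncationSeminorm z y :=
  ciSup_mono (bddAbove_range_norm_abs_inf z y) fun _ =>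
    norm_le_norm_of_nonneg_of_le (le_inf (abs_nonneg _) (abs_nonneg _)) (inf_le_inf_right _ h)

theorem norm_le_truncationSeminorm {z x : F} (h : |z| ≤ |x|) :
    ‖z‖ ≤ truncationSeminorm z x := by
  have := le_ciSup (bddAbove_range_norm_abs_inf z x) 1
  rwa [one_smul, inf_eq_right.mpr h, norm_abs_eq_norm] at this

/-- Truncations of `|w|` that nearly attain the suprema, up to `1 / (n + 1)`, form a disjoint
sequence in the solid hull of `{w}`. -/
theorem tendsto_truncationSeminorm {z : ℕ → F} (hz : IsDisjointSeq z) {w : F}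
    (hw : IsLwcSet {w}) : Tendsto (fun n => truncationSeminorm (z n) w) atTop (𝓝 0) := by
  have hk (n : ℕ) : ∃ k : ℝ,
      truncationSeminorm (z n) w - 1 / ((n : ℝ) + 1) < ‖|w| ⊓ |k • z n|‖ :=
    exists_lt_of_lt_ciSup (sub_lt_self _ Nat.one_div_pos_of_nat)
  choose k hk using hk
  have habs (n : ℕ) : |(|w| ⊓ |k n • z n|)| = |w| ⊓ |k n • z n| :=
    abs_of_nonneg (le_inf (abs_nonneg _) (abs_nonneg _))
  have hlim := hw (fun n => |w| ⊓ |k n • z n|)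
    (fun n => ⟨w, rfl, (habs n).trans_le inf_le_left⟩) (fun m n hmn => by
      rw [habs, habs]
      refine le_antisymm ?_
        (le_inf (le_inf (abs_nonneg _) (abs_nonneg _)) (le_inf (abs_nonneg _) (abs_nonneg _)))
      rw [← abs_smul_inf_abs_smul_eq_zero (hz m n hmn) (k m) (k n)]
      exact inf_le_inf inf_le_right inf_le_right)
  refine squeeze_zero (fun n => apply_nonneg _ _) (fun n => ?_)
    (by simpa only [add_zero] using
      hlim.add (tendsto_one_div_add_atTop_nhds_zero_nat (𝕜 := ℝ)))
  linarith [hk n]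

end Truncation

/-- Hahn–Banach: a seminorm dominated by the norm is attained at each point by a continuous
functional dominated by the seminorm. -/
theorem Seminorm.exists_continuousLinearMap_eq {F : Type*} [NormedAddCommGroup F]
    [NormedSpace ℝ F] (p : Seminorm ℝ F) (hp : ∀ x, p x ≤ ‖x‖) (x : F) :
    ∃ h : F →L[ℝ] ℝ, h x = p x ∧ ∀ y, |h y| ≤ p y := by
  have hzero (c : ℝ) (hc : c • x = 0) : RingHom.id ℝ c • p x = 0 := by
    rcases smul_eq_zero.mp hc with rfl | rfl <;> simp
  obtain ⟨g, hgx, hgp⟩ := exists_extension_of_le_sublinear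
    (LinearPMap.mkSpanSingleton' x (p x) hzero) p
    (fun c hc y => by rw [map_smul_eq_mul, Real.norm_of_nonneg hc.le]) (map_add_le_add p) (by
      rintro ⟨y, hy⟩
      obtain ⟨c, rfl⟩ := Submodule.mem_span_singleton.mp hy
      rw [LinearPMap.mkSpanSingleton'_apply, map_smul_eq_mul, Real.norm_eq_abs]
      exact mul_le_mul_of_nonneg_right (le_abs_self c) (apply_nonneg p x))
  have hg (y : F) : |g y| ≤ p y :=
    abs_le.mpr ⟨by linarith [hgp (-y), map_neg g y, map_neg_eq_map p y], hgp y⟩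
  refine ⟨g.mkContinuous 1 fun y => ?_, ?_, hg⟩
  · rw [one_mul]; exact (hg y).trans (hp y)
  · exact (hgx ⟨x, Submodule.mem_span_singleton_self x⟩).trans
      (LinearPMap.mkSpanSingleton'_apply_self x (p x) hzero _)

theorem isLimitedSet_singleton {X : Type*} [NormedAddCommGroup X] [NormedSpace ℝ X] (x : X) :
    IsLimitedSet {x} := by
  refine ⟨Bornology.isBounded_singleton, fun f hf => ?_⟩
  rw [tendstoUniformlyOn_singleton_iff_tendsto]
  exact ((WeakDual.eval_continuous x).tendsto 0).comp hf

theorem IsLimitedlyLwc.isLwcSet_singleton {X F : Type*} [NormedAddCommGroup X] [NormedSpace ℝ X]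
    [NormedAddCommGroup F] [NormedSpace ℝ F] [Lattice F] {T : X →L[ℝ] F} (hT : IsLimitedlyLwc T)
    (x : X) : IsLwcSet {T x} := by
  simpa using hT {x} (isLimitedSet_singleton x)

/-- Reduces uniform control on limited sets to pointwise control, which passes from `T` to `S` by
domination. -/
theorem isLimitedlyLwc_of_tendsto_truncationSeminorm {X F : Type*}
    [NormedAddCommGroup X] [NormedSpace ℝ X] [NormedAddCommGroup F] [NormedSpace ℝ F]
    [Lattice F] [IsOrderedAddMonoid F] [IsOrderedModule ℝ F] [HasSolidNorm F] {S : X →L[ℝ] F}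
    (hS : ∀ z : ℕ → F, IsDisjointSeq z → ∀ x,
      Tendsto (fun n => truncationSeminorm (z n) (S x)) atTop (𝓝 0)) :
    IsLimitedlyLwc S := by
  intro A hA z hzA hz
  have hex (n : ℕ) : ∃ a ∈ A, |z n| ≤ |S a| := by
    obtain ⟨_, ⟨a, ha, rfl⟩, hle⟩ := hzA n
    exact ⟨a, ha, hle⟩
  choose a ha hza using hex
  choose h hha hhp using fun n =>
    (truncationSeminorm (z n)).exists_continuousLinearMap_eq (truncationSeminorm_le_norm (z n))
      (S (a n))
  have hnull : Tendsto (fun n => StrongDual.toWeakDual ((h n).comp S)) atTop (𝓝 0) := by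
    rw [tendsto_iff_forall_eval_tendsto_topDualPairing]
    exact fun x => squeeze_zero_norm (fun n => hhp n (S x)) (hS z hz x)
  have hunif := Metric.tendstoUniformlyOn_iff.mp (hA.2 _ hnull)
  refine Metric.tendsto_atTop'.mpr fun ε hε => ?_
  obtain ⟨N, hN⟩ := eventually_atTop.mp (hunif ε hε)
  refine ⟨N, fun n hn => ?_⟩
  have hlt : |h n (S (a n))| < ε := by
    simpa [Real.dist_eq] using hN n hn.le (a n) (ha n)
  rw [hha] at hlt
  rw [Real.dist_eq, sub_zero, abs_norm]
  exact ((norm_le_truncationSeminorm (hza n)).trans (le_abs_self _)).trans_lt hlt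

theorem mainTheorem2
    {E : Type*} [NormedAddCommGroup E] [NormedSpace ℝ E] [CompleteSpace E]
    [Lattice E] [IsOrderedAddMonoid E] [IsOrderedModule ℝ E] [HasSolidNorm E]
    {F : Type*} [NormedAddCommGroup F] [NormedSpace ℝ F] [CompleteSpace F]
    [Lattice F] [IsOrderedAddMonoid F] [IsOrderedModule ℝ F] [HasSolidNorm F]
    (S T : E →L[ℝ] F)
    (hS : OperatorLE 0 S) (hST : OperatorLE S T) (hT : IsLimitedlyLwc T) :
    IsLimitedlyLwc S := by
  refine isLimitedlyLwc_of_tendsto_truncationSeminorm fun z hz x => ?_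
  have hpos (y : E) (hy : 0 ≤ y) :
      Tendsto (fun n => truncationSeminorm (z n) (S y)) atTop (𝓝 0) := by
    have hSy : 0 ≤ S y := hS y hy
    refine squeeze_zero (fun n => apply_nonneg _ _) (fun n => truncationSeminorm_mono (z n) ?_)
      (tendsto_truncationSeminorm hz (hT.isLwcSet_singleton y))
    rw [abs_of_nonneg hSy, abs_of_nonneg (hSy.trans (hST y hy))]
    exact hST y hy
  refine squeeze_zero (fun n => apply_nonneg _ _) (fun n => ?_)
    -- Domination only compares `S` and `T` on the positive cone, so `x` is split into `x⁺ - x⁻`.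
    (by simpa using (hpos x⁺ (posPart_nonneg x)).add (hpos x⁻ (negPart_nonneg x)))
  conv_lhs => rw [← posPart_sub_negPart x, map_sub]
  exact map_sub_le_add _ _ _
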